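/- **Conventions.** A differential structure on a topological space $S$ is a family $C^\infty(S)$ of real functions on $S$ such that (A1) the sets $f^{-1}((a,b))$, $f\in C^\infty(S)$, $a,b\in\mathbb R$, form a subbasis of the topology; (A2) $F(f_1,\dots,f_n)\in C^\infty(S)$ for all $f_i\in C^\infty(S)$ and $F\in C^\infty(\mathbb R^n)$; (A3) every function that locally agrees with members of $C^\infty(S)$ belongs to $C^\infty(S)$. A map $\varphi:R\to S$ of differential spaces is smooth if $f\circ\varphi\in C^\infty(R)$ for all $f\in C^\infty(S)$, and a diffeomorphism if it is bijective and $\varphi,\varphi^{-1}$ are smooth. A subset $A$ of a differential space $S$ carries the induced structure of all functions on $A$ that are, near each point of $A$, restrictions of members of $C^\infty(S)$. **Setting.** Let $G$ be a connected Lie group acting smoothly and properly on a (Hausdorff, paracompact, finite-dimensional) smooth manifold $M$, with orbit map $\pi:M\to M/G$. Put $C^\infty(M/G)=\{f\in C^0(M/G) : f\circ\pi\in C^\infty(M)\}$. For a subgroup $H\le G$ let $M_{(H)}=\{m\in M : G_m \text{ is conjugate to } H\}$, and let $P$ be a connected component of $M_{(H)}$; it is $G$-invariant. Let $\pi_P:P\to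 P/G$ be the orbit map of the restricted action, and let $\pi(P)\subseteq M/G$ carry the structure induced from $M/G$. **Proposition.** The set $\pi(P)$ is a connected component of $\pi(M_{(H)})$ (a stratum of $M/G$), the families above on $M/G$ and $\pi(P)$ are differential structures, and the map $$\Lambda: P/G\to\pi(P),\qquad \pi_P(p)\mapsto\pi(p),$$ is a well-defined bijection and a diffeomorphism of differential spaces, where $P/G$ carries the structure of all continuous $f$ such that $f\circ\pi_P$ is smooth for the structure induced on $P$ by $M$ (this is a differential structure too). Likewise, when $P$ is regarded as an embedded submanifold of $M$ and $P/G$ as the quotient manifold of $P$ (that is, for every smooth manifold structure on the space $P$ for which $P\hookrightarrow M$ is a smooth embedding and every smooth manifold structure on the space $P/G$ for which $\pi_P$ is a smooth submersion), $\Lambda$ is a diffeomorphism from $P/G$, with its smooth functions as a manifold, onto $\pi(P)$. -/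

import Mathlib

open scoped Manifold ContDiff

namespace DifferentialSpace

/-- A family `C` of real functions on a topological space `X` is a differential structure if
the preimages of open intervals form a subbasis of the topology, `C` is closed under composition
with smooth functions of several variables, and `C` contains every function that locally agrees
with members of `C`. -/
structure IsDifferentialStructure {X : Type*} [t : TopologicalSpace X] (C : Set (X → ℝ)) :
    Prop where
  subbasis : t = TopologicalSpace.generateFrom
    {s : Set X | ∃ f ∈ C, ∃ a b : ℝ, s = f ⁻¹' Set.Ioo a b}
  comp_mem : ∀ (n : ℕ) (f : Fin n → X → ℝ), (∀ i, f i ∈ C) →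
    ∀ F : (Fin n → ℝ) → ℝ, ContDiff ℝ ∞ F → (fun x => F (fun i => f i x)) ∈ C
  local_mem : ∀ f : X → ℝ,
    (∀ x : X, ∃ U : Set X, IsOpen U ∧ x ∈ U ∧ ∃ g ∈ C, Set.EqOn g f U) → f ∈ C

/-- A map is smooth if it pulls back functions of the target structure to functions of the
source structure. -/
def IsSmoothMap {R S : Type*} (CR : Set (R → ℝ)) (CS : Set (S → ℝ)) (φ : R → S) : Prop :=
  ∀ f ∈ CS, f ∘ φ ∈ CR

/-- An invertible map that is smooth together with its inverse. -/
def IsDiffeomorphism {R S : Type*} (CR : Set (R → ℝ)) (CS : Set (S → ℝ)) (φ : R ≃ S) : Prop :=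
  IsSmoothMap CR CS φ ∧ IsSmoothMap CS CR φ.symm

/-- The differential structure of a smooth manifold: the globally defined smooth functions. -/
def ofManifold {E : Type*} [NormedAddCommGroup E] [NormedSpace ℝ E] (M : Type*)
    [TopologicalSpace M] [ChartedSpace E M] : Set (M → ℝ) :=
  {f | ContMDiff 𝓘(ℝ, E) 𝓘(ℝ, ℝ) ∞ f}

/-- The structure induced on a subset: functions that are locally restrictions of members
of `C`. -/
def restrict {X : Type*} [TopologicalSpace X] (C : Set (X → ℝ)) (S : Set X) : Set (S → ℝ) :=
  {f | ∀ x : S, ∃ U : Set X, IsOpen U ∧ (x : X) ∈ U ∧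
    ∃ F ∈ C, ∀ y : S, (y : X) ∈ U → f y = F y}

/-- The structure on the orbit space of a `G`-space with structure `C`: continuous functions
whose pull-back along the orbit map belongs to `C`. -/
def orbitSpace (G : Type*) {X : Type*} [Group G] [MulAction G X] [TopologicalSpace X]
    (C : Set (X → ℝ)) : Set (MulAction.orbitRel.Quotient G X → ℝ) :=
  {f | Continuous f ∧ (fun x : X => f (Quotient.mk _ x)) ∈ C}

end DifferentialSpace

namespace OrbitType

section

variable (G : Type*) {M : Type*} [Group G] [MulAction G M]

/-- The orbit map `M → M/G`. -/
def orbitMap (x : M) : MulAction.orbitRel.Quotient G M := Quotient.mk _ x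

variable {G}

/-- The orbit type set `M_(H)` of points whose isotropy group is conjugate to `H`. -/
def orbitTypeSet (M : Type*) [MulAction G M] (H : Subgroup G) : Set M :=
  {m | ∃ g : G, MulAction.stabilizer G m = H.map (MulAut.conj g).toMonoidHom}

theorem smul_mem_orbitTypeSet {H : Subgroup G} {m : M} (hm : m ∈ orbitTypeSet M H) (g : G) :
    g • m ∈ orbitTypeSet M H := by
  obtain ⟨k, hk⟩ := hm
  refine ⟨g * k, ?_⟩
  rw [MulAction.stabilizer_smul_eq_stabilizer_map_conj, hk, Subgroup.map_map, map_mul]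
  rfl

variable [TopologicalSpace G] [ConnectedSpace G] [TopologicalSpace M] [ContinuousSMul G M]

theorem smul_mem_component (H : Subgroup G) (m₀ : M) (g : G) {p : M}
    (hp : p ∈ connectedComponentIn (orbitTypeSet M H) m₀) :
    g • p ∈ connectedComponentIn (orbitTypeSet M H) m₀ := by
  have hpS : p ∈ orbitTypeSet M H := connectedComponentIn_subset _ _ hp
  rw [connectedComponentIn_eq hp]
  have hc : IsPreconnected (Set.range fun k : G => k • p) :=
    isPreconnected_range (continuous_id.smul continuous_const)
  refine hc.subset_connectedComponentIn ⟨1, one_smul G p⟩ ?_ ⟨g, rfl⟩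
  rintro _ ⟨k, rfl⟩
  exact smul_mem_orbitTypeSet hpS k

/-- The connected component `P` through `m₀` of the orbit type set `M_(H)`, with the action of the
connected group `G` restricted to it. -/
def component (H : Subgroup G) (m₀ : M) : SubMulAction G M where
  carrier := connectedComponentIn (orbitTypeSet M H) m₀
  smul_mem' g _ hp := smul_mem_component H m₀ g hp

/-- The image `π(P)` of the component `P` in the orbit space `M/G`. -/
def stratum (H : Subgroup G) (m₀ : M) : Set (MulAction.orbitRel.Quotient G M) :=
  orbitMap G '' (component H m₀ : Set M)

end

end OrbitType

open DifferentialSpace OrbitType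

/-! The pull-back half of the diffeomorphism is formal: a smooth function on `π(P)` is locally a
restriction from `M/G`, and composing with orbit maps preserves this. The content is the converse. A
function `f` on `P/G`, pulled back to `P`, agrees near `p` with some smooth `u` on `M`, but `u` need
not be invariant. Choose a bump function `b` at `p` supported where the agreement holds, and average
`b * u` and `b` over `G` with Haar measure. On an orbit inside `P` the function `u` equals the
constant value of `f` wherever `b ≠ 0`, so the quotient of the two averages is invariant, smooth
near the orbit of `p`, and equal to `f` on nearby points of `P`; it descends to `M/G`. This is
`exists_invariant_average` and `exists_invariant_extension`. No slice theorem is needed.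

Properness gives the averaged integrands compact support in `G`, locally uniformly in the point, so
averages are smooth by differentiation under the integral. Averaged bump functions also separate
orbits from closed invariant sets, which yields the subbasis axiom on orbit spaces.

For the manifold version, smooth functions on an embedded submanifold extend locally and submersions
have local smooth sections, so the two families of functions on `P/G` coincide. That `π(P)` is a
component follows because the orbit map is open with connected fibres. -/

section

open MeasureTheory Set Filter Topology

/-! ### Differentiation under the integral sign over a parameter manifold. -/

section ParametricIntegral

variable {EN : Type*} [NormedAddCommGroup EN] [NormedSpace ℝ EN]
  {N : Type*} [TopologicalSpace N] [ChartedSpace EN N]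
  {E : Type*} [NormedAddCommGroup E] [NormedSpace ℝ E]

/-- The partial derivative in a vector variable of a jointly smooth function is jointly smooth. -/
theorem ContMDiffOn.fderiv_snd [IsManifold 𝓘(ℝ, EN) ∞ N] {f : N → E → ℝ} {U : Set E}
    (hU : IsOpen U)
    (hf : ContMDiffOn (𝓘(ℝ, EN).prod 𝓘(ℝ, E)) 𝓘(ℝ, ℝ) ∞ (fun p : N × E => f p.1 p.2)
      (univ ×ˢ U)) :
    ContMDiffOn (𝓘(ℝ, EN).prod 𝓘(ℝ, E)) 𝓘(ℝ, E →L[ℝ] ℝ) ∞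
      (fun p : N × E => fderiv ℝ (f p.1) p.2) (univ ×ˢ U) := by
  rintro ⟨x, e⟩ hxe
  have hn : (univ ×ˢ U : Set (N × E)) ∈ 𝓝 (x, e) := (isOpen_univ.prod hU).mem_nhds hxe
  have h1 : ContMDiffAt (𝓘(ℝ, EN).prod 𝓘(ℝ, E)) 𝓘(ℝ, ℝ) ∞
      (fun p : N × E => f p.1 p.2) (x, e) := (hf _ hxe).contMDiffAt hn
  -- The family is indexed by the whole pair `p = (x, e)`, so that the base point `e` of the
  -- derivative may vary with the parameter.
  have h2 : ContMDiffAt ((𝓘(ℝ, EN).prod 𝓘(ℝ, E)).prod 𝓘(ℝ, E)) 𝓘(ℝ, ℝ) ∞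
      (Function.uncurry fun (p : N × E) (e' : E) => f p.1 e') ((x, e), e) := by
    refine ContMDiffAt.comp (g := fun p : N × E => f p.1 p.2)
      (f := fun q : (N × E) × E => (q.1.1, q.2)) ((x, e), e) h1 ?_
    exact (contMDiffAt_fst.comp _ contMDiffAt_fst).prodMk contMDiffAt_snd
  have h3 := ContMDiffAt.mfderiv (m := ∞) (fun (p : N × E) (e' : E) => f p.1 e')
    (fun p : N × E => p.2) h2 contMDiffAt_snd le_rfl
  have h4 := inTangentCoordinates_model_space (I := 𝓘(ℝ, E)) (I' := 𝓘(ℝ, ℝ))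
    (fun p : N × E => p.2) (fun p => f p.1 p.2) (fun p => fderiv ℝ (f p.1) p.2) (x, e)
  rw [← h4]
  simp only [mfderiv_eq_fderiv] at h3
  exact h3.contMDiffWithinAt

variable [T2Space N] [MeasurableSpace N] [BorelSpace N] (μ : Measure N)
  [IsFiniteMeasureOnCompacts μ] [FiniteDimensional ℝ E]

theorem hasFDerivAt_integral_of_contMDiffOn [IsManifold 𝓘(ℝ, EN) ∞ N] {f : N → E → ℝ} {U : Set E}
    (hU : IsOpen U) {K : Set N} (hK : IsCompact K) (h0 : ∀ x ∉ K, ∀ e ∈ U, f x e = 0)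
    (hf : ContMDiffOn (𝓘(ℝ, EN).prod 𝓘(ℝ, E)) 𝓘(ℝ, ℝ) ∞ (fun p : N × E => f p.1 p.2)
      (univ ×ˢ U)) {e : E} (he : e ∈ U) :
    Integrable (fun x => fderiv ℝ (f x) e) μ ∧
      HasFDerivAt (fun e => ∫ x, f x e ∂μ) (∫ x, fderiv ℝ (f x) e ∂μ) e := by
  have hcont : ∀ e ∈ U, Continuous fun x => f x e := fun e he => by
    rw [← continuousOn_univ]
    exact hf.continuousOn.comp (f := fun x => (x, e)) (by fun_prop) (fun x _ => ⟨mem_univ _, he⟩)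
  have hf' := (hf.fderiv_snd hU).continuousOn
  have hcont' : ∀ e ∈ U, Continuous fun x => fderiv ℝ (f x) e := fun e he => by
    rw [← continuousOn_univ]
    exact hf'.comp (f := fun x => (x, e)) (by fun_prop) (fun x _ => ⟨mem_univ _, he⟩)
  have h0' : ∀ x ∉ K, ∀ e ∈ U, fderiv ℝ (f x) e = 0 := fun x hx e he => by
    have : f x =ᶠ[𝓝 e] fun _ => 0 := by
      filter_upwards [hU.mem_nhds he] with e' he' using h0 x hx e' he'
    rw [this.fderiv_eq, fderiv_fun_const]; rfl
  have hdiff : ∀ x, ∀ e ∈ U, DifferentiableAt ℝ (f x) e := fun x e he => by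
    have h1 : ContMDiffAt 𝓘(ℝ, E) 𝓘(ℝ, ℝ) ∞ (f x) e :=
      ContMDiffAt.comp (g := fun p : N × E => f p.1 p.2) (f := fun e => (x, e)) e
        ((hf (x, e) ⟨mem_univ _, he⟩).contMDiffAt ((isOpen_univ.prod hU).mem_nhds
          ⟨mem_univ _, he⟩)) (contMDiffAt_const.prodMk contMDiffAt_id)
    exact h1.contDiffAt.differentiableAt (by simp)
  have : ProperSpace E := FiniteDimensional.proper ℝ E
  -- The derivative is bounded by some `C` on the compact set `K × s`, so `C` times the indicator of
  -- `K` is an integrable dominating function.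
  obtain ⟨s, hs, hsU, hsc⟩ := local_compact_nhds (hU.mem_nhds he)
  obtain ⟨C, hC⟩ := (hK.prod hsc).exists_bound_of_continuousOn
    (hf'.mono (prod_mono (subset_univ _) hsU))
  refine ⟨(hcont' e he).integrable_of_hasCompactSupport
    (HasCompactSupport.intro hK fun x hx => h0' x hx e he), ?_⟩
  refine hasFDerivAt_integral_of_dominated_of_fderiv_le (s := s)
    (F := fun e x => f x e) (F' := fun e x => fderiv ℝ (f x) e)
    (bound := K.indicator fun _ => C) hs ?_ ?_ ?_ ?_ ?_ ?_
  · filter_upwards [hU.mem_nhds he] with e' he' using (hcont e' he').aestronglyMeasurable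
  · exact (hcont e he).integrable_of_hasCompactSupport
      (HasCompactSupport.intro hK fun x hx => h0 x hx e he)
  · exact (hcont' e he).aestronglyMeasurable
  · refine Eventually.of_forall fun x e' he' => ?_
    by_cases hx : x ∈ K
    · simpa [hx] using hC (x, e') ⟨hx, he'⟩
    · simp [hx, h0' x hx e' (hsU he')]
  · exact (integrable_indicator_iff hK.measurableSet).2
      (integrableOn_const hK.measure_lt_top.ne)
  · exact Eventually.of_forall fun x e' he' => (hdiff x e' (hsU he')).hasFDerivAt

/-- Differentiation under the integral sign: integrating a jointly smooth function over a
parameter manifold, with uniformly compact support, yields a smooth function. -/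
theorem contDiffOn_integral_of_contMDiffOn [IsManifold 𝓘(ℝ, EN) ∞ N] {U : Set E}
    (hU : IsOpen U) {K : Set N} (hK : IsCompact K) {f : N → E → ℝ}
    (h0 : ∀ x ∉ K, ∀ e ∈ U, f x e = 0)
    (hf : ContMDiffOn (𝓘(ℝ, EN).prod 𝓘(ℝ, E)) 𝓘(ℝ, ℝ) ∞ (fun p : N × E => f p.1 p.2)
      (univ ×ˢ U)) :
    ContDiffOn ℝ ∞ (fun e => ∫ x, f x e ∂μ) U := by
  rw [contDiffOn_infty]
  intro n
  -- The function varies in the induction because each directional derivative satisfies the same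
  -- smoothness and support hypotheses.
  induction n generalizing f with
  | zero =>
    exact contDiffOn_zero.2 fun e he =>
      (hasFDerivAt_integral_of_contMDiffOn μ hU hK h0 hf he).2.continuousAt.continuousWithinAt
  | succ n ih =>
    push_cast
    refine contDiffOn_succ_of_fderiv_apply (fun e he =>
      (hasFDerivAt_integral_of_contMDiffOn μ hU hK h0 hf he).2.differentiableAt
        |>.differentiableWithinAt) (by simp) fun v => ?_
    refine (ih (f := fun x e => fderiv ℝ (f x) e v) ?_ ?_).congr ?_
    · intro x hx e he
      have : f x =ᶠ[𝓝 e] fun _ => 0 := by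
        filter_upwards [hU.mem_nhds he] with e' he' using h0 x hx e' he'
      rw [this.fderiv_eq, fderiv_fun_const]; rfl
    · exact (hf.fderiv_snd hU).clm_apply contMDiffOn_const
    · intro e he
      obtain ⟨hi, hd⟩ := hasFDerivAt_integral_of_contMDiffOn μ hU hK h0 hf he
      rw [fderivWithin_of_isOpen hU he, hd.fderiv, ContinuousLinearMap.integral_apply hi]

end ParametricIntegral

/-! ### Averages over a proper action. -/

section Averaging

/-- The set is the projection to `G` of the preimage of `A × B` under the proper map `(g, y) ↦ (g •
y, y)`. This is how properness of the action enters the averages. -/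
theorem ProperSMul.isCompact_setOf_inv_smul_mem {G X : Type*} [Group G] [TopologicalSpace G]
    [TopologicalSpace X] [MulAction G X] [ProperSMul G X] {A B : Set X} (hA : IsCompact A)
    (hB : IsCompact B) : IsCompact {g : G | ∃ x ∈ A, g⁻¹ • x ∈ B} := by
  have h := (ProperSMul.isProperMap_smul_pair (G := G) (X := X)).isCompact_preimage (hA.prod hB)
  convert h.image continuous_fst using 1
  ext g
  constructor
  · rintro ⟨x, hx, hgx⟩
    exact ⟨(g, g⁻¹ • x), ⟨by simpa using hx, hgx⟩, rfl⟩
  · rintro ⟨⟨g, y⟩, ⟨h1, h2⟩, rfl⟩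
    exact ⟨g • y, h1, by simpa using h2⟩

variable {G M : Type*} [Group G] [MulAction G M] [MeasurableSpace G]

/-- The integral of `u` over the orbits of `G`, weighted by the measure `μ` on `G`. -/
noncomputable def orbitIntegral (μ : Measure G) (u : M → ℝ) (m : M) : ℝ :=
  ∫ g, u (g⁻¹ • m) ∂μ

theorem orbitIntegral_smul [MeasurableMul G] (μ : Measure G) [μ.IsMulLeftInvariant]
    (u : M → ℝ) (h : G) (m : M) : orbitIntegral μ u (h • m) = orbitIntegral μ u m := by
  unfold orbitIntegral
  -- Substitute `h * g` for `g`: then `(h * g)⁻¹ • h • m = g⁻¹ • m`.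
  rw [← integral_mul_left_eq_self (fun g => u (g⁻¹ • h • m)) h]
  simp [mul_smul]

theorem exists_ne_zero_of_orbitIntegral_ne_zero {μ : Measure G} {u : M → ℝ} {m : M}
    (h : orbitIntegral μ u m ≠ 0) : ∃ g : G, u (g • m) ≠ 0 := by
  by_contra! hu
  exact h (by simp [orbitIntegral, hu])

theorem orbitIntegral_eq_mul {μ : Measure G} {u v : M → ℝ} {m : M} {c : ℝ}
    (h : ∀ g : G, v (g • m) = c * u (g • m)) :
    orbitIntegral μ v m = c * orbitIntegral μ u m := by
  simp only [orbitIntegral, h, integral_const_mul]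

variable [TopologicalSpace G] [BorelSpace G]
  [TopologicalSpace M] [ProperSMul G M]

theorem orbitIntegral_pos [IsTopologicalGroup G] (μ : Measure G) [IsFiniteMeasureOnCompacts μ]
    [μ.IsOpenPosMeasure]
    {u : M → ℝ} (hu : Continuous u) (hc : HasCompactSupport u) (h0 : ∀ m, 0 ≤ u m) {m : M}
    (hm : u m ≠ 0) : 0 < orbitIntegral μ u m := by
  refine Continuous.integral_pos_of_hasCompactSupport_nonneg_nonzero (x := 1) ?_ ?_
    (fun g => h0 _) (by simpa using hm)
  · exact hu.comp (continuous_inv.smul continuous_const)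
  · refine HasCompactSupport.intro (ProperSMul.isCompact_setOf_inv_smul_mem (G := G)
      (isCompact_singleton (x := m)) hc) fun g hg => ?_
    by_contra h
    exact hg ⟨m, rfl, subset_tsupport _ h⟩

/-- Smoothness is checked in a chart at `m`. For points in a compact neighbourhood `A` of `m`, the
integrand vanishes for `g` outside one compact subset of `G`, which supplies the uniform support
needed to differentiate under the integral. -/
theorem contMDiff_orbitIntegral [T2Space G]
    {EG : Type*} [NormedAddCommGroup EG] [NormedSpace ℝ EG] [ChartedSpace EG G]
    [LieGroup 𝓘(ℝ, EG) ∞ G]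
    {EM : Type*} [NormedAddCommGroup EM] [NormedSpace ℝ EM] [FiniteDimensional ℝ EM]
    [ChartedSpace EM M] [IsManifold 𝓘(ℝ, EM) ∞ M] [ContMDiffSMul 𝓘(ℝ, EG) 𝓘(ℝ, EM) ∞ G M]
    (μ : Measure G) [IsFiniteMeasureOnCompacts μ] {u : M → ℝ}
    (hu : ContMDiff 𝓘(ℝ, EM) 𝓘(ℝ, ℝ) ∞ u) (hc : HasCompactSupport u) :
    ContMDiff 𝓘(ℝ, EM) 𝓘(ℝ, ℝ) ∞ (orbitIntegral μ u) := by
  intro m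
  have : LocallyCompactSpace M := Manifold.locallyCompact_of_finiteDimensional 𝓘(ℝ, EM)
  obtain ⟨A, hA, hAm⟩ := exists_compact_mem_nhds m
  set φ := extChartAt 𝓘(ℝ, EM) m
  have hφ : ContMDiffOn 𝓘(ℝ, EM) 𝓘(ℝ, EM) ∞ φ.symm φ.target := contMDiffOn_extChartAt_symm m
  have hm : m ∈ φ.source := mem_extChartAt_source m
  have hmA : φ.symm ⁻¹' A ∈ 𝓝 (φ m) := extChartAt_preimage_mem_nhds hAm
  set U : Set EM := interior (φ.symm ⁻¹' A) ∩ φ.target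
  have hU : IsOpen U := isOpen_interior.inter (isOpen_extChartAt_target m)
  have hmU : φ m ∈ U := ⟨mem_interior_iff_mem_nhds.2 hmA, mem_extChartAt_target m⟩
  have hsmooth : ContDiffOn ℝ ∞ (fun e => ∫ g : G, u (g⁻¹ • φ.symm e) ∂μ) U := by
    refine contDiffOn_integral_of_contMDiffOn (EN := EG) μ hU
      (ProperSMul.isCompact_setOf_inv_smul_mem (G := G) hA hc) (f := fun g e => u (g⁻¹ • φ.symm e))
      ?_ ?_
    · intro g hg e he
      by_contra h
      exact hg ⟨φ.symm e, interior_subset (s := φ.symm ⁻¹' A) he.1, subset_tsupport _ h⟩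
    · refine hu.comp_contMDiffOn ?_
      have h1 : ContMDiffOn (𝓘(ℝ, EG).prod 𝓘(ℝ, EM)) 𝓘(ℝ, EG) ∞ (fun p : G × EM => p.1⁻¹)
          (univ ×ˢ U) := (contMDiff_fst.inv).contMDiffOn
      have h2 : ContMDiffOn (𝓘(ℝ, EG).prod 𝓘(ℝ, EM)) 𝓘(ℝ, EM) ∞
          (fun p : G × EM => φ.symm p.2) (univ ×ˢ U) :=
        hφ.comp contMDiffOn_snd fun p hp => hp.2.2
      exact (contMDiff_smul (I := 𝓘(ℝ, EG)) (I' := 𝓘(ℝ, EM)) (n := ∞)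
        (G := G) (M := M)).comp_contMDiffOn (h1.prodMk h2)
  have h3 : ContMDiffAt 𝓘(ℝ, EM) 𝓘(ℝ, ℝ) ∞
      ((fun e => ∫ g : G, u (g⁻¹ • φ.symm e) ∂μ) ∘ φ) m :=
    ((hsmooth.contDiffAt (hU.mem_nhds hmU)).contMDiffAt).comp m contMDiffAt_extChartAt
  refine h3.congr_of_eventuallyEq ?_
  filter_upwards [extChartAt_source_mem_nhds (I := 𝓘(ℝ, EM)) m] with x hx
  simp only [Function.comp, orbitIntegral, φ, (extChartAt 𝓘(ℝ, EM) m).left_inv hx]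

end Averaging

/-! ### Differential structures on manifolds, subsets and orbit spaces. -/

namespace DifferentialSpace

theorem eq_generateFrom_of_separating {X : Type*} [t : TopologicalSpace X] {C : Set (X → ℝ)}
    (hC : ∀ f ∈ C, Continuous f)
    (hsep : ∀ (x : X) (U : Set X), IsOpen U → x ∈ U → ∃ f ∈ C, 0 < f x ∧ ∀ y, 0 < f y → y ∈ U) :
    t = TopologicalSpace.generateFrom {s : Set X | ∃ f ∈ C, ∃ a b : ℝ, s = f ⁻¹' Ioo a b} := by
  refine le_antisymm (le_generateFrom ?_) ?_
  · rintro _ ⟨f, hf, a, b, rfl⟩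
    exact isOpen_Ioo.preimage (hC f hf)
  · intro U hU
    refine (@isOpen_iff_forall_mem_open X (TopologicalSpace.generateFrom _) U).2 fun x hx => ?_
    obtain ⟨f, hf, hfx, hfU⟩ := hsep x U hU hx
    exact ⟨f ⁻¹' Ioo 0 (f x + 1), fun y hy => hfU y hy.1,
      TopologicalSpace.isOpen_generateFrom_of_mem ⟨f, hf, _, _, rfl⟩, hfx, by simp⟩

namespace IsDifferentialStructure

variable {X : Type*} [TopologicalSpace X] {C : Set (X → ℝ)}

theorem continuous (hC : IsDifferentialStructure C) {f : X → ℝ} (hf : f ∈ C) : Continuous f := by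
  refine continuous_iff_continuousAt.2 fun x => ?_
  have hI : ∀ a b, IsOpen (f ⁻¹' Ioo a b) := fun a b => by
    have h := TopologicalSpace.isOpen_generateFrom_of_mem
      (g := {s : Set X | ∃ f ∈ C, ∃ a b : ℝ, s = f ⁻¹' Ioo a b}) ⟨f, hf, a, b, rfl⟩
    rwa [← hC.subbasis] at h
  refine ((nhds_basis_Ioo (f x)).tendsto_right_iff).2 fun ⟨a, b⟩ h => ?_
  exact (hI a b).mem_nhds h

theorem restrict (hC : IsDifferentialStructure C) (S : Set X) :
    IsDifferentialStructure (restrict C S) where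
  subbasis := by
    refine le_antisymm (le_generateFrom ?_) ?_
    · rintro _ ⟨f, hf, a, b, rfl⟩
      refine isOpen_Ioo.preimage (continuous_iff_continuousAt.2 fun x => ?_)
      obtain ⟨U, hU, hxU, F, hF, h⟩ := hf x
      refine ((hC.continuous hF).comp continuous_subtype_val).continuousAt.congr ?_
      filter_upwards [(hU.preimage continuous_subtype_val).mem_nhds hxU] with y hy
      exact (h y hy).symm
    · have h : (instTopologicalSpaceSubtype : TopologicalSpace S) =
          TopologicalSpace.induced Subtype.val (TopologicalSpace.generateFrom
            {s : Set X | ∃ f ∈ C, ∃ a b : ℝ, s = f ⁻¹' Ioo a b}) := by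
        rw [← hC.subbasis]; rfl
      rw [h, induced_generateFrom_eq]
      refine le_generateFrom ?_
      rintro _ ⟨_, ⟨f, hf, a, b, rfl⟩, rfl⟩
      exact TopologicalSpace.isOpen_generateFrom_of_mem
        ⟨fun y => f y, fun x => ⟨univ, isOpen_univ, mem_univ _, f, hf, fun _ _ => rfl⟩, a, b, rfl⟩
  comp_mem n f hf F hF x := by
    choose U hU hxU g hg h using fun i => hf i x
    exact ⟨⋂ i, U i, isOpen_iInter_of_finite hU, mem_iInter.2 hxU, _, hC.comp_mem n g hg F hF,
      fun y hy => congrArg F (funext fun i => h i y (mem_iInter.1 hy i))⟩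
  local_mem f hf x := by
    obtain ⟨U, hU, hxU, g, hg, h⟩ := hf x
    obtain ⟨V, hV, rfl⟩ := isOpen_induced_iff.1 hU
    obtain ⟨W, hW, hxW, F, hF, h'⟩ := hg x
    exact ⟨V ∩ W, hV.inter hW, ⟨hxU, hxW⟩, F, hF,
      fun y hy => (h hy.1).symm.trans (h' y hy.2)⟩

/-- The hypothesis `hsep` asks for invariant functions positive only on the saturation of `V`.
Applied to the preimage of an open set of the quotient, which is already saturated, they descend to
functions separating points from closed sets. -/
theorem orbitSpace {G : Type*} [Group G] [MulAction G X] (hC : IsDifferentialStructure C)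
    (hsep : ∀ (x : X) (V : Set X), IsOpen V → x ∈ V → ∃ F ∈ C,
      (∀ (g : G) y, F (g • y) = F y) ∧ 0 < F x ∧ ∀ y, 0 < F y → ∃ g : G, g • y ∈ V) :
    IsDifferentialStructure (orbitSpace G C) where
  subbasis := by
    refine eq_generateFrom_of_separating (fun f hf => hf.1) fun x U hU hxU => ?_
    induction x using Quotient.inductionOn with | _ x
    obtain ⟨F, hF, hFG, hFx, hFU⟩ := hsep x _ (hU.preimage continuous_quotient_mk') hxU
    refine ⟨Quotient.lift F ?_, ⟨?_, hF⟩, hFx, fun y hy => ?_⟩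
    · rintro _ b ⟨g, rfl⟩
      exact hFG g b
    · exact (hC.continuous hF).quotient_lift _
    · induction y using Quotient.inductionOn with | _ y
      obtain ⟨g, hg⟩ := hFU y hy
      have : (Quotient.mk (MulAction.orbitRel G X) (g • y)) = Quotient.mk _ y :=
        Quotient.sound ⟨g, rfl⟩
      rw [← this]
      exact hg
  comp_mem n f hf F hF :=
    ⟨hF.continuous.comp (continuous_pi fun i => (hf i).1),
      hC.comp_mem n (fun i x => f i (Quotient.mk _ x)) (fun i => (hf i).2) F hF⟩
  local_mem f hf := by
    refine ⟨continuous_iff_continuousAt.2 fun x => ?_, hC.local_mem _ fun x => ?_⟩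
    · obtain ⟨U, hU, hxU, g, hg, h⟩ := hf x
      exact hg.1.continuousAt.congr (h.eventuallyEq_of_mem (hU.mem_nhds hxU))
    · obtain ⟨U, hU, hxU, g, hg, h⟩ := hf (Quotient.mk _ x)
      exact ⟨_, hU.preimage continuous_quotient_mk', hxU, _, hg.2, fun y hy => h hy⟩

end IsDifferentialStructure

theorem isDifferentialStructure_ofManifold {E : Type*} [NormedAddCommGroup E] [NormedSpace ℝ E]
    [FiniteDimensional ℝ E] (M : Type*) [TopologicalSpace M] [ChartedSpace E M] [T2Space M]
    [IsManifold 𝓘(ℝ, E) ∞ M] : IsDifferentialStructure (ofManifold (E := E) M) where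
  subbasis := by
    refine eq_generateFrom_of_separating (fun f hf => ContMDiff.continuous hf)
      fun x U hU hxU => ?_
    obtain ⟨b, -, hb⟩ := (SmoothBumpFunction.nhds_basis_tsupport (I := 𝓘(ℝ, E)) x).mem_iff.1
      (hU.mem_nhds hxU)
    exact ⟨b, b.contMDiff, by simp, fun y hy => hb (subset_tsupport _ hy.ne')⟩
  comp_mem n f hf F hF :=
    hF.contMDiff.comp (contMDiff_pi_space.2 hf)
  local_mem f hf x := by
    obtain ⟨U, hU, hxU, g, hg, h⟩ := hf x
    exact (hg x).congr_of_eventuallyEq (h.eventuallyEq_of_mem (hU.mem_nhds hxU)).symm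

end DifferentialSpace

/-! ### Invariant functions and invariant extensions. -/

section InvariantFunctions

variable {G : Type*} [Group G] [TopologicalSpace G] [T2Space G]
  {M : Type*} [TopologicalSpace M] [T2Space M] [MulAction G M] [ProperSMul G M]

variable (G) in
/-- Invariant smooth functions obtained by averaging a bump function and its product with a given
smooth function, whose ratio recovers that function wherever it is constant along orbits. -/
theorem exists_invariant_average
    (EG : Type*) [NormedAddCommGroup EG] [NormedSpace ℝ EG] [FiniteDimensional ℝ EG]
    [ChartedSpace EG G] [LieGroup 𝓘(ℝ, EG) ∞ G]
    (EM : Type*) [NormedAddCommGroup EM] [NormedSpace ℝ EM] [FiniteDimensional ℝ EM]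
    [ChartedSpace EM M] [IsManifold 𝓘(ℝ, EM) ∞ M] [ContMDiffSMul 𝓘(ℝ, EG) 𝓘(ℝ, EM) ∞ G M]
    {p : M} {V : Set M} (hV : V ∈ 𝓝 p) :
    ∃ D : M → ℝ, ContMDiff 𝓘(ℝ, EM) 𝓘(ℝ, ℝ) ∞ D ∧ (∀ (g : G) m, D (g • m) = D m) ∧ 0 < D p ∧
      (∀ m, 0 < D m → ∃ g : G, g • m ∈ V) ∧
      ∀ u : M → ℝ, ContMDiff 𝓘(ℝ, EM) 𝓘(ℝ, ℝ) ∞ u →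
        ∃ N : M → ℝ, ContMDiff 𝓘(ℝ, EM) 𝓘(ℝ, ℝ) ∞ N ∧ (∀ (g : G) m, N (g • m) = N m) ∧
          ∀ (m : M) (c : ℝ), (∀ g : G, g • m ∈ V → u (g • m) = c) → N m = c * D m := by
  have : IsTopologicalGroup G := topologicalGroup_of_lieGroup 𝓘(ℝ, EG) ∞
  have : LocallyCompactSpace G := Manifold.locallyCompact_of_finiteDimensional 𝓘(ℝ, EG)
  let : MeasurableSpace G := borel G
  have : BorelSpace G := ⟨rfl⟩
  let μ : Measure G := Measure.haar
  obtain ⟨b, -, hb⟩ := (SmoothBumpFunction.nhds_basis_tsupport (I := 𝓘(ℝ, EM)) p).mem_iff.1 hV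
  -- `D` is the average of the bump function `b`, and `N` that of `b * u`.
  refine ⟨orbitIntegral μ b, contMDiff_orbitIntegral (EG := EG) μ b.contMDiff b.hasCompactSupport,
    orbitIntegral_smul μ b,
    orbitIntegral_pos μ b.continuous b.hasCompactSupport (fun _ => b.nonneg) (by simp),
    fun m hm => ?_, fun u hu => ⟨orbitIntegral μ (b * u), ?_, orbitIntegral_smul μ _, ?_⟩⟩
  · obtain ⟨g, hg⟩ := exists_ne_zero_of_orbitIntegral_ne_zero hm.ne'
    exact ⟨g, hb (subset_tsupport _ hg)⟩
  · exact contMDiff_orbitIntegral (EG := EG) μ (b.contMDiff.mul hu) b.hasCompactSupport.mul_right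
  · refine fun m c h => orbitIntegral_eq_mul fun g => ?_
    by_cases hg : g • m ∈ V
    · simp [h g hg, mul_comm]
    · have : b (g • m) = 0 := by
        by_contra h0
        exact hg (hb (subset_tsupport _ h0))
      simp [this]

/-- A globally smooth substitute for inversion, used to divide by `D` without shrinking the domain.
The cutoff argument `2 * t / d - 1` is nonpositive for `t ≤ d / 2` and at least `1` for `t ≥ d`. -/
theorem exists_contDiff_eqOn_inv {d : ℝ} (hd : 0 < d) :
    ∃ θ : ℝ → ℝ, ContDiff ℝ ∞ θ ∧ ∀ t, d < t → θ t = t⁻¹ := by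
  refine ⟨fun t => Real.smoothTransition (2 * t / d - 1) * t⁻¹, ?_, fun t ht => ?_⟩
  · refine contDiff_iff_contDiffAt.2 fun t => ?_
    rcases lt_or_ge 0 t with ht | ht
    · have h1 : ContDiff ℝ ∞ fun t : ℝ => 2 * t / d - 1 := by fun_prop
      exact (Real.smoothTransition.contDiff.comp h1).contDiffAt.mul
        (contDiffAt_inv ℝ ht.ne')
    · refine (contDiffAt_const (c := (0 : ℝ))).congr_of_eventuallyEq ?_
      filter_upwards [Iio_mem_nhds (show t < d / 2 by linarith)] with s hs
      rw [Real.smoothTransition.zero_of_nonpos, zero_mul]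
      rw [sub_nonpos, div_le_one hd]
      linarith [mem_Iio.1 hs]
  · have : Real.smoothTransition (2 * t / d - 1) = 1 := by
      refine Real.smoothTransition.one_of_one_le ?_
      have : 2 ≤ 2 * t / d := by rw [le_div_iff₀ hd]; linarith
      linarith
    simp [this]

/-- An invariant function on an invariant subset that extends smoothly near a point extends to an
invariant smooth function near the orbit of that point. -/
theorem exists_invariant_extension
    (EG : Type*) [NormedAddCommGroup EG] [NormedSpace ℝ EG] [FiniteDimensional ℝ EG]
    [ChartedSpace EG G] [LieGroup 𝓘(ℝ, EG) ∞ G]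
    (EM : Type*) [NormedAddCommGroup EM] [NormedSpace ℝ EM] [FiniteDimensional ℝ EM]
    [ChartedSpace EM M] [IsManifold 𝓘(ℝ, EM) ∞ M] [ContMDiffSMul 𝓘(ℝ, EG) 𝓘(ℝ, EM) ∞ G M]
    (P : SubMulAction G M) {f : P → ℝ}
    (hf : ∀ (g : G) q, f (g • q) = f q) {p : P} {V : Set M} (hV : V ∈ 𝓝 (p : M)) {u : M → ℝ}
    (hu : ContMDiff 𝓘(ℝ, EM) 𝓘(ℝ, ℝ) ∞ u) (hfu : ∀ q : P, (q : M) ∈ V → f q = u q) :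
    ∃ D F : M → ℝ, ContMDiff 𝓘(ℝ, EM) 𝓘(ℝ, ℝ) ∞ D ∧ ContMDiff 𝓘(ℝ, EM) 𝓘(ℝ, ℝ) ∞ F ∧
      (∀ (g : G) m, D (g • m) = D m) ∧ (∀ (g : G) m, F (g • m) = F m) ∧ 0 < D p ∧
      ∀ q : P, 0 < D q → f q = F q := by
  obtain ⟨D, hD, hDG, hDp, -, h⟩ := exists_invariant_average G EG EM hV
  obtain ⟨N, hN, hNG, hND⟩ := h u hu
  obtain ⟨θ, hθ, hθi⟩ := exists_contDiff_eqOn_inv (half_pos hDp)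
  -- Shifting by `D p / 2` makes positivity of the new `D` mean that the old one exceeds `D p / 2`,
  -- exactly where `θ` is inversion and the extension is `N / D`.
  refine ⟨fun m => D m - D p / 2, fun m => N m * θ (D m), hD.sub contMDiff_const,
    hN.mul (hθ.contMDiff.comp hD), by simp [hDG], by simp [hDG, hNG], by linarith, fun q hq => ?_⟩
  have hq' : D p / 2 < D q := by linarith
  have h1 := hND q (f q) fun g hg => by
    rw [← hf g q]
    exact (hfu (g • q) hg).symm
  have h2 : D q ≠ 0 := by linarith
  simp only [h1, hθi _ hq']
  field_simp

end InvariantFunctions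

/-! ### Smooth functions along embeddings and submersions. -/

section SubmanifoldFunctions

variable {E : Type*} [NormedAddCommGroup E] [NormedSpace ℝ E]
  {E' : Type*} [NormedAddCommGroup E'] [NormedSpace ℝ E']
  {P : Type*} [TopologicalSpace P] [ChartedSpace E P]
  {Q : Type*} [TopologicalSpace Q] [ChartedSpace E' Q]

/-- A smooth function on an embedded submanifold is locally the restriction of a globally defined
smooth function. -/
theorem Manifold.IsSmoothEmbedding.exists_extension [FiniteDimensional ℝ E'] [T2Space Q]
    [IsManifold 𝓘(ℝ, E') ∞ Q] {ι : P → Q} (hι : IsSmoothEmbedding 𝓘(ℝ, E) 𝓘(ℝ, E') ∞ ι) {f : P → ℝ}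
    (hf : ContMDiff 𝓘(ℝ, E) 𝓘(ℝ, ℝ) ∞ f) (p : P) :
    ∃ U : Set Q, IsOpen U ∧ ι p ∈ U ∧ ∃ F : Q → ℝ, ContMDiff 𝓘(ℝ, E') 𝓘(ℝ, ℝ) ∞ F ∧
      ∀ q, ι q ∈ U → f q = F (ι q) := by
  have h := hι.isImmersion.isImmersionAt p
  set φ := h.domChart.extend 𝓘(ℝ, E)
  set ψ := h.codChart.extend 𝓘(ℝ, E')
  -- In immersion charts `ι` is the inclusion of the first factor, so `pr` is a smooth left inverse;
  -- composing `f` with the resulting local retraction extends it.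
  let pr : E' → E := fun e => (h.equiv.symm e).1
  have hpr : ContDiff ℝ ∞ pr := contDiff_fst.comp h.equiv.symm.contDiff
  have hφs : φ.source = h.domChart.source := h.domChart.extend_source
  have hψs : ψ.source = h.codChart.source := h.codChart.extend_source
  have hret : ∀ q ∈ h.domChart.source, pr (ψ (ι q)) = φ q := fun q hq => by
    have h1 := h.writtenInCharts (φ.map_source (hφs ▸ hq))
    simp only [Function.comp] at h1
    rw [φ.left_inv (hφs ▸ hq)] at h1
    simp only [pr, ψ, h1, h.equiv.symm_apply_apply]
  have hψ : ContMDiffOn 𝓘(ℝ, E') 𝓘(ℝ, E') ∞ ψ h.codChart.source :=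
    contMDiffOn_of_mem_maximalAtlas h.codChart_mem_maximalAtlas
  have hφt : IsOpen φ.target := h.domChart.isOpen_extend_target
  have hφ : ContMDiffOn 𝓘(ℝ, E) 𝓘(ℝ, E) ∞ φ.symm φ.target := by
    convert contMDiffOn_extend_symm h.domChart_mem_maximalAtlas using 1
    simp [φ, OpenPartialHomeomorph.extend]
  let V : Set Q := h.codChart.source ∩ (fun q => pr (ψ q)) ⁻¹' φ.target
  have hV : IsOpen V :=
    (hpr.continuous.comp_continuousOn hψ.continuousOn).isOpen_inter_preimage
      h.codChart.open_source hφt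
  have hpV : ι p ∈ V := by
    refine ⟨h.mem_codChart_source, ?_⟩
    simp only [mem_preimage, hret p h.mem_domChart_source]
    exact φ.map_source (hφs ▸ h.mem_domChart_source)
  have hr : ContMDiffOn 𝓘(ℝ, E') 𝓘(ℝ, ℝ) ∞ (fun q => f (φ.symm (pr (ψ q)))) V :=
    hf.comp_contMDiffOn (hφ.comp (hpr.contMDiff.comp_contMDiffOn (hψ.mono inter_subset_left))
      fun q hq => hq.2)
  obtain ⟨b, -, hb⟩ := (SmoothBumpFunction.nhds_basis_tsupport (I := 𝓘(ℝ, E')) (ι p)).mem_iff.1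
    (hV.mem_nhds hpV)
  -- Here the topological embedding is used, beyond immersion: points of `P` outside the chart whose
  -- images come close to `ι p` are excluded by `W`.
  obtain ⟨W, hW, hWs⟩ := hι.isEmbedding.isOpen_iff.1 h.domChart.open_source
  refine ⟨W ∩ interior {q | b q = 1}, hW.inter isOpen_interior, ⟨?_, ?_⟩,
    fun q => b q * f (φ.symm (pr (ψ q))), ?_, fun q hq => ?_⟩
  · exact (hWs ▸ h.mem_domChart_source : p ∈ ι ⁻¹' W)
  · exact mem_interior_iff_mem_nhds.2 b.eventuallyEq_one
  · refine contMDiff_of_tsupport fun q hq => ?_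
    have hqV : q ∈ V := hb (tsupport_mul_subset_left hq)
    exact b.contMDiff.contMDiffAt.mul (hr.contMDiffAt (hV.mem_nhds hqV))
  · have hqs : q ∈ h.domChart.source := hWs ▸ hq.1
    have hb1 : b (ι q) = 1 := interior_subset (s := {q | b q = 1}) hq.2
    simp only [hb1, one_mul, hret q hqs]
    rw [φ.left_inv (hφs ▸ hqs)]

/-- A function is smooth at the image of a point under a submersion if its pull-back is smooth. -/
theorem Manifold.IsSubmersionAt.contMDiffAt_of_comp {π : P → Q} {p : P}
    (h : IsSubmersionAt 𝓘(ℝ, E) 𝓘(ℝ, E') ∞ π p) {f : Q → ℝ}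
    (hf : ContMDiff 𝓘(ℝ, E) 𝓘(ℝ, ℝ) ∞ (f ∘ π)) : ContMDiffAt 𝓘(ℝ, E') 𝓘(ℝ, ℝ) ∞ f (π p) := by
  set φ := h.domChart.extend 𝓘(ℝ, E)
  set ψ := h.codChart.extend 𝓘(ℝ, E')
  have hφs : φ.source = h.domChart.source := h.domChart.extend_source
  have hψs : ψ.source = h.codChart.source := h.codChart.extend_source
  have hφt : IsOpen φ.target := h.domChart.isOpen_extend_target
  have hφ : ContMDiffOn 𝓘(ℝ, E) 𝓘(ℝ, E) ∞ φ.symm φ.target := by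
    convert contMDiffOn_extend_symm h.domChart_mem_maximalAtlas using 1
    simp [φ, OpenPartialHomeomorph.extend]
  have hψ : ContMDiffAt 𝓘(ℝ, E') 𝓘(ℝ, E') ∞ ψ (π p) :=
    (contMDiffOn_of_mem_maximalAtlas h.codChart_mem_maximalAtlas).contMDiffAt
      (h.codChart.open_source.mem_nhds h.mem_codChart_source)
  have hp : p ∈ φ.source := hφs ▸ h.mem_domChart_source
  have hwr : ∀ e ∈ φ.target, ψ (π (φ.symm e)) = (h.equiv e).1 := fun e he => h.writtenInCharts he
  -- A local section of `π` in charts: the base coordinate varies and the fibre coordinate stays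
  -- that of `p`.
  let s : Q → E := fun q => h.equiv.symm (ψ q, (h.equiv (φ p)).2)
  have hs : ContMDiffAt 𝓘(ℝ, E') 𝓘(ℝ, E) ∞ s (π p) :=
    (h.equiv.symm.contDiff.contMDiff.contMDiffAt).comp (π p)
      (hψ.prodMk_space contMDiffAt_const)
  have hsp : s (π p) = φ p := by
    have h1 := hwr (φ p) (φ.map_source hp)
    rw [φ.left_inv hp] at h1
    simp only [s, h1, Prod.mk.eta, h.equiv.symm_apply_apply]
  have hst : s (π p) ∈ φ.target := hsp ▸ φ.map_source hp
  have hcomp : ContMDiffAt 𝓘(ℝ, E') 𝓘(ℝ, ℝ) ∞ (fun q => (f ∘ π) (φ.symm (s q))) (π p) :=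
    hf.contMDiffAt.comp (π p)
      (ContMDiffAt.comp (π p) (hφ.contMDiffAt (hφt.mem_nhds hst)) hs)
  refine hcomp.congr_of_eventuallyEq ?_
  filter_upwards [hs.continuousAt.preimage_mem_nhds (hφt.mem_nhds hst),
    h.codChart.open_source.mem_nhds h.mem_codChart_source] with q hq hqs
  have h2 : ψ (π (φ.symm (s q))) = ψ q := by
    rw [hwr _ hq]
    simp [s]
  have h3 : π (φ.symm (s q)) ∈ ψ.source :=
    hψs ▸ h.source_subset_preimage_source (hφs ▸ φ.map_target hq)
  simp only [Function.comp, ψ.injOn h3 (hψs ▸ hqs) h2]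

end SubmanifoldFunctions

/-! ### Components of the quotient and comparison of the structures. -/

section OrbitSpace

/-- An open quotient map, unlike a general one, remains a quotient map when restricted over an
arbitrary subset `S`. With connected fibres it then carries components onto components. -/
theorem IsOpenQuotientMap.image_connectedComponentIn_preimage {X Y : Type*} [TopologicalSpace X]
    [TopologicalSpace Y] {π : X → Y} (hπ : IsOpenQuotientMap π)
    (hfib : ∀ y, IsConnected (π ⁻¹' {y})) (S : Set Y) {x : X} (hx : π x ∈ S) :
    π '' connectedComponentIn (π ⁻¹' S) x = connectedComponentIn S (π x) := by
  let π' : π ⁻¹' S → S := S.restrictPreimage π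
  have hπ' : IsOpenQuotientMap π' :=
    ⟨hπ.surjective.restrictPreimage S, hπ.continuous.restrictPreimage,
      hπ.isOpenMap.restrictPreimage S⟩
  have hfib' : ∀ y, IsConnected (π' ⁻¹' {y}) := fun y => by
    have h1 : IsConnected ((↑) ⁻¹' (π ⁻¹' {(y : Y)}) : Set (π ⁻¹' S)) := by
      have h2 : ((↑) '' ((↑) ⁻¹' (π ⁻¹' {(y : Y)}) : Set (π ⁻¹' S)) : Set X) = π ⁻¹' {(y : Y)} := by
        rw [Subtype.image_preimage_coe, inter_eq_right]
        exact preimage_mono (singleton_subset_iff.2 y.2)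
      have h3 := h2 ▸ hfib y
      exact ⟨h3.nonempty.of_image, IsInducing.subtypeVal.isPreconnected_image.1 h3.isPreconnected⟩
    convert h1 using 1
    ext z
    simp [π', Subtype.ext_iff]
  have h := hπ'.isQuotientMap.isCoinducing.image_connectedComponent hfib' ⟨x, hx⟩
  rw [connectedComponentIn_eq_image (show x ∈ π ⁻¹' S from hx), connectedComponentIn_eq_image hx]
  have h2 : π' ⟨x, hx⟩ = ⟨π x, hx⟩ := rfl
  rw [← h2, ← h, image_image, image_image]
  rfl

theorem MulAction.isConnected_preimage_orbitMap {G M : Type*} [Group G] [MulAction G M]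
    [TopologicalSpace G] [ConnectedSpace G] [TopologicalSpace M] [ContinuousSMul G M]
    (y : MulAction.orbitRel.Quotient G M) : IsConnected (orbitMap G ⁻¹' {y}) := by
  induction y using Quotient.inductionOn with | _ m
  have h : orbitMap G ⁻¹' {(Quotient.mk _ m : MulAction.orbitRel.Quotient G M)} =
      range fun g : G => g • m := by
    ext x
    exact Quotient.eq
  rw [h]
  exact isConnected_range (continuous_id.smul continuous_const)

theorem OrbitType.stratum_eq_connectedComponentIn {G M : Type*} [Group G] [MulAction G M]
    [TopologicalSpace G] [ConnectedSpace G] [TopologicalSpace M] [ContinuousSMul G M]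
    (H : Subgroup G) {m₀ : M} (hm₀ : m₀ ∈ orbitTypeSet M H) :
    stratum H m₀ = connectedComponentIn (orbitMap G '' orbitTypeSet M H) (orbitMap G m₀) := by
  -- Orbit type sets are saturated, so the component may be taken in the preimage of the image.
  have hsat : orbitMap G ⁻¹' (orbitMap G '' orbitTypeSet M H) = orbitTypeSet M H := by
    refine (subset_preimage_image _ _).antisymm' ?_
    rintro x ⟨y, hy, hyx⟩
    obtain ⟨g, rfl⟩ : x ∈ MulAction.orbit G y := Quotient.exact hyx.symm
    exact smul_mem_orbitTypeSet hy g
  have h := (MulAction.isOpenQuotientMap_quotientMk (Γ := G)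
    (T := M)).image_connectedComponentIn_preimage MulAction.isConnected_preimage_orbitMap
      (orbitMap G '' orbitTypeSet M H) (x := m₀) ⟨m₀, hm₀, rfl⟩
  change orbitMap G '' connectedComponentIn (orbitMap G ⁻¹' _) m₀ = _ at h
  rw [hsat] at h
  exact h

/-- The orbit space of an invariant subset `P`, identified with the image of `P` in the ambient
orbit space. -/
noncomputable def orbitSpaceImageEquiv {G M : Type*} [Group G] [MulAction G M]
    (P : SubMulAction G M) :
    MulAction.orbitRel.Quotient G P ≃ (orbitMap G '' (P : Set M)) :=
  Equiv.ofBijective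
    (Quotient.lift (fun p : P => ⟨orbitMap G (p : M), p, p.2, rfl⟩) (by
      rintro _ q ⟨g, rfl⟩
      exact Subtype.ext (Quotient.sound ⟨g, rfl⟩)))
    ⟨by
      intro x y h
      induction x using Quotient.inductionOn with | _ p
      induction y using Quotient.inductionOn with | _ q
      obtain ⟨g, hg⟩ : (p : M) ∈ MulAction.orbit G (q : M) :=
        Quotient.exact (congrArg Subtype.val h)
      exact Quotient.sound ⟨g, Subtype.ext hg⟩, by
      rintro ⟨_, p, hp, rfl⟩
      exact ⟨Quotient.mk _ ⟨p, hp⟩, rfl⟩⟩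

variable {G : Type*} [Group G] [TopologicalSpace G] [T2Space G]
  {M : Type*} [TopologicalSpace M] [T2Space M] [MulAction G M] [ProperSMul G M]

theorem isDifferentialStructure_orbitSpace
    (EG : Type*) [NormedAddCommGroup EG] [NormedSpace ℝ EG] [FiniteDimensional ℝ EG]
    (G : Type*) [Group G] [TopologicalSpace G] [T2Space G]
    [ChartedSpace EG G] [LieGroup 𝓘(ℝ, EG) ∞ G]
    (EM : Type*) [NormedAddCommGroup EM] [NormedSpace ℝ EM] [FiniteDimensional ℝ EM]
    (M : Type*) [TopologicalSpace M] [T2Space M] [MulAction G M] [ProperSMul G M]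
    [ChartedSpace EM M] [IsManifold 𝓘(ℝ, EM) ∞ M] [ContMDiffSMul 𝓘(ℝ, EG) 𝓘(ℝ, EM) ∞ G M] :
    IsDifferentialStructure (orbitSpace G (ofManifold (E := EM) M)) := by
  refine (isDifferentialStructure_ofManifold M).orbitSpace fun x V hV hx => ?_
  obtain ⟨D, hD, hDG, hDx, hDV, -⟩ := exists_invariant_average G EG EM (hV.mem_nhds hx)
  exact ⟨D, hD, hDG, hDx, hDV⟩

/-- The separating functions are restrictions to `P` of averages formed on `M`. -/
theorem isDifferentialStructure_orbitSpace_restrict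
    (EG : Type*) [NormedAddCommGroup EG] [NormedSpace ℝ EG] [FiniteDimensional ℝ EG]
    [ChartedSpace EG G] [LieGroup 𝓘(ℝ, EG) ∞ G]
    (EM : Type*) [NormedAddCommGroup EM] [NormedSpace ℝ EM] [FiniteDimensional ℝ EM]
    [ChartedSpace EM M] [IsManifold 𝓘(ℝ, EM) ∞ M] [ContMDiffSMul 𝓘(ℝ, EG) 𝓘(ℝ, EM) ∞ G M]
    (P : SubMulAction G M) :
    IsDifferentialStructure (orbitSpace G (X := P) (restrict (ofManifold (E := EM) M) P)) := by
  refine ((isDifferentialStructure_ofManifold (E := EM) M).restrict (P : Set M)).orbitSpace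
    (G := G) (X := P) fun x V hV hx => ?_
  obtain ⟨W, hW, rfl⟩ := isOpen_induced_iff.1 hV
  obtain ⟨D, hD, hDG, hDx, hDV, -⟩ := exists_invariant_average G EG EM (hW.mem_nhds hx)
  exact ⟨fun y => D y, fun _ => ⟨univ, isOpen_univ, mem_univ _, D, hD, fun _ _ => rfl⟩,
    fun g y => hDG g y, hDx, fun y hy => hDV y hy⟩

theorem isDiffeomorphism_orbitSpaceImageEquiv
    (EG : Type*) [NormedAddCommGroup EG] [NormedSpace ℝ EG] [FiniteDimensional ℝ EG]
    [ChartedSpace EG G] [LieGroup 𝓘(ℝ, EG) ∞ G]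
    (EM : Type*) [NormedAddCommGroup EM] [NormedSpace ℝ EM] [FiniteDimensional ℝ EM]
    [ChartedSpace EM M] [IsManifold 𝓘(ℝ, EM) ∞ M] [ContMDiffSMul 𝓘(ℝ, EG) 𝓘(ℝ, EM) ∞ G M]
    (P : SubMulAction G M) :
    IsDiffeomorphism (orbitSpace G (X := P) (restrict (ofManifold (E := EM) M) P))
      (restrict (orbitSpace G (ofManifold (E := EM) M)) (orbitMap G '' (P : Set M)))
      (orbitSpaceImageEquiv P) := by
  have hπ : Continuous (orbitMap G : M → _) := continuous_quotient_mk'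
  constructor
  · intro f hf
    have hfP : (fun p : P => f (orbitSpaceImageEquiv P (Quotient.mk _ p))) ∈
        restrict (ofManifold (E := EM) M) P := fun p => by
      obtain ⟨U, hU, hpU, F, hF, h⟩ := hf (orbitSpaceImageEquiv P (Quotient.mk _ p))
      exact ⟨orbitMap G ⁻¹' U, hU.preimage hπ, hpU, _, hF.2, fun q hq => h _ hq⟩
    refine ⟨?_, hfP⟩
    exact continuous_coinduced_dom.2
      (((isDifferentialStructure_ofManifold (E := EM) M).restrict (P : Set M)).continuous hfP)
  · rintro f ⟨-, hf⟩ ⟨_, p, hp, rfl⟩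
    obtain ⟨V, hV, hpV, u, hu, hfu⟩ := hf ⟨p, hp⟩
    obtain ⟨D, F, hD, hF, hDG, hFG, hDp, hDF⟩ := exists_invariant_extension EG EM P
      (f := fun p => f (Quotient.mk _ p)) (fun g q => congrArg f (Quotient.sound ⟨g, rfl⟩))
      (p := ⟨p, hp⟩) (hV.mem_nhds hpV) hu hfu
    have hlift : ∀ {A : M → ℝ}, (∀ (g : G) m, A (g • m) = A m) → ∀ a b : M,
        (MulAction.orbitRel G M) a b → A a = A b := by
      rintro A hA _ b ⟨g, rfl⟩
      exact hA g b
    -- Both invariant functions descend to `M/G`: `D` cuts out an open neighbourhood of `π(p)`, and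
    -- `F` is the required local extension there.
    refine ⟨Quotient.lift D (hlift hDG) ⁻¹' Ioi 0,
      isOpen_Ioi.preimage (hD.continuous.quotient_lift _), hDp,
      Quotient.lift F (hlift hFG), ⟨hF.continuous.quotient_lift _, hF⟩, ?_⟩
    rintro ⟨_, q, hq, rfl⟩ hDq
    have hsymm : (orbitSpaceImageEquiv P).symm ⟨orbitMap G q, q, hq, rfl⟩ =
        Quotient.mk _ (⟨q, hq⟩ : P) := (Equiv.symm_apply_eq _).2 rfl
    simp only [Function.comp, hsymm]
    exact hDF ⟨q, hq⟩ hDq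

/-- On a quotient manifold of an embedded submanifold, smooth functions are those
whose pull-back locally extends to a smooth function on the ambient manifold. -/
theorem ofManifold_eq_orbitSpace_restrict {G : Type*} [Group G]
    {M : Type*} [TopologicalSpace M] [T2Space M] [MulAction G M]
    {EM : Type*} [NormedAddCommGroup EM] [NormedSpace ℝ EM] [FiniteDimensional ℝ EM]
    [ChartedSpace EM M] [IsManifold 𝓘(ℝ, EM) ∞ M] (P : SubMulAction G M)
    {E : Type*} [NormedAddCommGroup E] [NormedSpace ℝ E] [ChartedSpace E P]
    {E' : Type*} [NormedAddCommGroup E'] [NormedSpace ℝ E']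
    [ChartedSpace E' (MulAction.orbitRel.Quotient G P)]
    (hemb : Manifold.IsSmoothEmbedding 𝓘(ℝ, E) 𝓘(ℝ, EM) ∞ (Subtype.val : P → M))
    (hsub : ∀ p : P, Manifold.IsSubmersionAt 𝓘(ℝ, E) 𝓘(ℝ, E') ∞
      (orbitMap G : P → MulAction.orbitRel.Quotient G P) p) :
    ofManifold (E := E') (MulAction.orbitRel.Quotient G P) =
      orbitSpace G (X := P) (restrict (ofManifold (E := EM) M) P) := by
  ext f
  constructor
  · intro hf
    have hfπ : ContMDiff 𝓘(ℝ, E) 𝓘(ℝ, ℝ) ∞ fun p : P => f (orbitMap G p) :=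
      ContMDiff.comp hf fun p => (hsub p).contMDiffAt
    exact ⟨ContMDiff.continuous hf, fun p => hemb.exists_extension hfπ p⟩
  · rintro ⟨-, hf⟩ x
    induction x using Quotient.inductionOn with | _ p
    refine (hsub p).contMDiffAt_of_comp fun q => ?_
    obtain ⟨U, hU, hqU, F, hF, h⟩ := hf q
    refine (ContMDiff.comp hF hemb.contMDiff q).congr_of_eventuallyEq ?_
    filter_upwards [(hU.preimage continuous_subtype_val).mem_nhds hqU] with r hr
    exact h r hr

end OrbitSpace

end

theorem proposition5p1
    {EG : Type*} [NormedAddCommGroup EG] [NormedSpace ℝ EG] [FiniteDimensional ℝ EG]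
    {G : Type*} [Group G] [TopologicalSpace G] [ChartedSpace EG G] [T2Space G]
    [LieGroup 𝓘(ℝ, EG) ∞ G] [ConnectedSpace G]
    {EM : Type*} [NormedAddCommGroup EM] [NormedSpace ℝ EM] [FiniteDimensional ℝ EM]
    {M : Type*} [TopologicalSpace M] [ChartedSpace EM M] [T2Space M] [ParacompactSpace M]
    [IsManifold 𝓘(ℝ, EM) ∞ M]
    [MulAction G M] [ContMDiffSMul 𝓘(ℝ, EG) 𝓘(ℝ, EM) ∞ G M] [ProperSMul G M]
    (H : Subgroup G) (m₀ : M) (hm₀ : m₀ ∈ orbitTypeSet M H) :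
    -- `π(P)` is a stratum of `M/G`: a connected component of `π(M_(H))`
    stratum H m₀ = connectedComponentIn (orbitMap G '' orbitTypeSet M H) (orbitMap G m₀) ∧
    -- `M/G` and `P/G` are differential spaces, and so is `π(P)` as a subset of `M/G`
    IsDifferentialStructure (orbitSpace G (ofManifold (E := EM) M)) ∧
    IsDifferentialStructure
      (orbitSpace G (X := component H m₀) (restrict (ofManifold (E := EM) M) (component H m₀))) ∧
    IsDifferentialStructure
      (restrict (orbitSpace G (ofManifold (E := EM) M)) (stratum H m₀)) ∧
    ∃ Λ : MulAction.orbitRel.Quotient G (component H m₀) ≃ stratum H m₀,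
      (∀ p : component H m₀, (Λ (orbitMap G p) : MulAction.orbitRel.Quotient G M)
        = orbitMap G (p : M)) ∧
      -- `P` as a differential subspace of `M`, `P/G` as its orbit space
      IsDiffeomorphism
        (orbitSpace G (X := component H m₀) (restrict (ofManifold (E := EM) M) (component H m₀)))
        (restrict (orbitSpace G (ofManifold (E := EM) M)) (stratum H m₀)) Λ ∧
      -- `P` as an embedded submanifold of `M`, `P/G` as the quotient manifold of `P`
      ∀ (n k : ℕ)
        [ChartedSpace (EuclideanSpace ℝ (Fin n)) (component H m₀)]
        [IsManifold (𝓡 n) ∞ (component H m₀)]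
        [ChartedSpace (EuclideanSpace ℝ (Fin k))
          (MulAction.orbitRel.Quotient G (component H m₀))]
        [IsManifold (𝓡 k) ∞ (MulAction.orbitRel.Quotient G (component H m₀))],
        Manifold.IsSmoothEmbedding (𝓡 n) 𝓘(ℝ, EM) ∞ (Subtype.val : component H m₀ → M) →
        (∀ p : component H m₀, Manifold.IsSubmersionAt (𝓡 n) (𝓡 k) ∞
          (orbitMap G : component H m₀ → MulAction.orbitRel.Quotient G (component H m₀)) p) →
        IsDiffeomorphism
          (ofManifold (E := EuclideanSpace ℝ (Fin k))
            (MulAction.orbitRel.Quotient G (component H m₀)))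
          (restrict (orbitSpace G (ofManifold (E := EM) M)) (stratum H m₀)) Λ := by
  have : ContinuousSMul G M := ProperSMul.toContinuousSMul
  have hdiff := isDiffeomorphism_orbitSpaceImageEquiv EG EM (component H m₀)
  refine ⟨stratum_eq_connectedComponentIn H hm₀, isDifferentialStructure_orbitSpace EG G EM M,
    isDifferentialStructure_orbitSpace_restrict EG EM (component H m₀),
    (isDifferentialStructure_orbitSpace EG G EM M).restrict _,
    orbitSpaceImageEquiv (component H m₀), fun _ => rfl, hdiff, ?_⟩
  intro n k _ _ _ _ hemb hsub
  -- The quotient manifold has the same smooth functions as the orbit space, so the first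
  -- diffeomorphism is also the second.
  rw [ofManifold_eq_orbitSpace_restrict (component H m₀) hemb hsub]
  exact hdiff
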